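/- Let $\mathcal T$ be a finite double groupoid (a groupoid object in finite groupoids), with set of points $\mathcal P$, horizontal arrows $\mathcal H\rightrightarrows\mathcal P$ (source $l$, target $r$), vertical arrows $\mathcal V\rightrightarrows\mathcal P$ (source $t$, target $b$), and boxes $\mathcal B$. A box $A$ has top and bottom sides $t(A),b(A)\in\mathcal H$, left and right sides $l(A),r(A)\in\mathcal V$, and vertices $tl(A),tr(A),bl(A),br(A)\in\mathcal P$. Write $XY$ for the horizontal composite of boxes (defined if $r(X)=l(Y)$), $A^{-1}$ for the total (horizontal and vertical) inverse of a box, and $\mathrm{id}\,x\in\mathcal B$ for the identity of $x\in\mathcal H$ with respect to vertical composition. Let $\Bbbk$ be a field of characteristic zero and $\vartheta:\mathcal P\to\Bbbk^\times$ a function such that $$\sum_{W\in\mathcal B:\ t(W)=x,\ r(W)=g}\vartheta(bl(W))=1\qquad\text{for all } x\in\mathcal H,\ g\in\mathcal V \text{ with } r(x)=t(g).$$ Let $\Bbbk^{(\vartheta)}\mathcal T$ be the vector space with basis $\mathcal B$, where $A.B$ is the vertical composite ($A$ above $B$) if $b(A)=t(B)$ and $0$ otherwise, with unit $1=\sum_{x\in\mathcal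 H}\mathrm{id}\,x$, and $$\Delta(A)=\sum_{XY=A}\vartheta(bl(Y))\,X\otimes Y,$$ with counit $\epsilon(A)=\vartheta(bl(A))^{-1}$ if $A$ is the identity (for horizontal composition) of a vertical arrow, and $\epsilon(A)=0$ otherwise. Let $\mathcal S$ be the linear map with $\mathcal S(A)=\frac{\vartheta(tr(A))}{\vartheta(br(A))}A^{-1}$ for $A\in\mathcal B$. Then $\mathcal S$ is the antipode of $\Bbbk^{(\vartheta)}\mathcal T$ in the sense of weak Hopf algebras: $m(\mathrm{id}\otimes\mathcal S)\Delta=\epsilon_t$, $m(\mathcal S\otimes\mathrm{id})\Delta=\epsilon_s$ and $m^{(2)}(\mathcal S\otimes\mathrm{id}\otimes\mathcal S)\Delta^{(2)}=\mathcal S$, where $\epsilon_t(h)=(\epsilon\otimes\mathrm{id})(\Delta(1)(h\otimes1))$ and $\epsilon_s(h)=(\mathrm{id}\otimes\epsilon)((1\otimes h)\Delta(1))$. Moreover the element $$G=\sum_{x\in\mathcal H}\frac{\vartheta(l(x))}{\vartheta(r(x))}\,\mathrm{id}\,x$$ is a pivotal element of $\Bbbk^{(\vartheta)}\mathcal T$;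 that is, it is group-like, meaning that $G$ is invertible and $\Delta(G)=\Delta(1)(G\otimes G)=(G\otimes G)\Delta(1)$, and it implements the square of the antipode by conjugation: $\mathcal S^2(a)=G^{-1}aG$ for all $a\in\Bbbk^{(\vartheta)}\mathcal T$. -/

import Mathlib

open scoped TensorProduct

/-- A groupoid `Ar ⇉ Ob` presented by its set of objects `Ob` and its set of all arrows `Ar`.
Composition is written in diagrammatic order: `comp f g h` is the arrow "first `f`, then `g`". -/
structure ArrowGroupoid (Ob : Type*) (Ar : Type*) where
  src : Ar → Ob
  tgt : Ar → Ob
  ident : Ob → Ar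
  comp : ∀ f g : Ar, tgt f = src g → Ar
  inv : Ar → Ar
  src_ident : ∀ p, src (ident p) = p
  tgt_ident : ∀ p, tgt (ident p) = p
  src_comp : ∀ f g h, src (comp f g h) = src f
  tgt_comp : ∀ f g h, tgt (comp f g h) = tgt g
  src_inv : ∀ f, src (inv f) = tgt f
  tgt_inv : ∀ f, tgt (inv f) = src f
  ident_comp : ∀ f, comp (ident (src f)) f (tgt_ident _) = f
  comp_ident : ∀ f, comp f (ident (tgt f)) (src_ident _).symm = f
  comp_assoc : ∀ f g k (h₁ : tgt f = src g) (h₂ : tgt g = src k),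
    comp (comp f g h₁) k ((tgt_comp f g h₁).trans h₂) =
      comp f (comp g k h₂) (h₁.trans (src_comp g k h₂).symm)
  comp_inv : ∀ f, comp f (inv f) (src_inv f).symm = ident (src f)
  inv_comp : ∀ f, comp (inv f) f (tgt_inv f) = ident (tgt f)

/-- A double groupoid, i.e. a groupoid object in the category of groupoids, given by four
groupoids on sets of points `P`, horizontal arrows `H`, vertical arrows `V` and boxes `B`:
`hor : H ⇉ P` (source = left, target = right), `ver : V ⇉ P` (source = top, target = bottom),
`boxH : B ⇉ V` (horizontal composition of boxes; source = left side, target = right side),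
`boxV : B ⇉ H` (vertical composition of boxes; source = top side, target = bottom side). -/
structure DoubleGroupoid (P H V B : Type*) where
  hor : ArrowGroupoid P H
  ver : ArrowGroupoid P V
  boxH : ArrowGroupoid V B
  boxV : ArrowGroupoid H B
  -- the four vertices of a box are well defined
  corner_tl : ∀ A, hor.src (boxV.src A) = ver.src (boxH.src A)
  corner_tr : ∀ A, hor.tgt (boxV.src A) = ver.src (boxH.tgt A)
  corner_bl : ∀ A, hor.src (boxV.tgt A) = ver.tgt (boxH.src A)
  corner_br : ∀ A, hor.tgt (boxV.tgt A) = ver.tgt (boxH.tgt A)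
  -- sides of the composites
  top_comp : ∀ A A' (h : boxH.tgt A = boxH.src A'),
    boxV.src (boxH.comp A A' h) =
      hor.comp (boxV.src A) (boxV.src A') (by rw [corner_tr, h, corner_tl])
  bot_comp : ∀ A A' (h : boxH.tgt A = boxH.src A'),
    boxV.tgt (boxH.comp A A' h) =
      hor.comp (boxV.tgt A) (boxV.tgt A') (by rw [corner_br, h, corner_bl])
  left_comp : ∀ A A' (h : boxV.tgt A = boxV.src A'),
    boxH.src (boxV.comp A A' h) =
      ver.comp (boxH.src A) (boxH.src A') (by rw [← corner_bl, h, corner_tl])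
  right_comp : ∀ A A' (h : boxV.tgt A = boxV.src A'),
    boxH.tgt (boxV.comp A A' h) =
      ver.comp (boxH.tgt A) (boxH.tgt A') (by rw [← corner_br, h, corner_tr])
  -- sides of the identity boxes
  top_ident : ∀ g, boxV.src (boxH.ident g) = hor.ident (ver.src g)
  bot_ident : ∀ g, boxV.tgt (boxH.ident g) = hor.ident (ver.tgt g)
  left_ident : ∀ x, boxH.src (boxV.ident x) = ver.ident (hor.src x)
  right_ident : ∀ x, boxH.tgt (boxV.ident x) = ver.ident (hor.tgt x)
  -- the two identity maps are functors, and agree on points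
  ident_ident : ∀ p, boxV.ident (hor.ident p) = boxH.ident (ver.ident p)
  identV_comp : ∀ x y (h : hor.tgt x = hor.src y),
    boxV.ident (hor.comp x y h) =
      boxH.comp (boxV.ident x) (boxV.ident y) (by rw [right_ident, left_ident, h])
  identH_comp : ∀ f g (h : ver.tgt f = ver.src g),
    boxH.ident (ver.comp f g h) =
      boxV.comp (boxH.ident f) (boxH.ident g) (by rw [bot_ident, top_ident, h])
  -- the interchange law for a two by two array with rows `A A'` and `C C'`
  interchange : ∀ A A' C C' (h₁ : boxH.tgt A = boxH.src A') (h₂ : boxH.tgt C = boxH.src C')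
    (h₃ : boxV.tgt A = boxV.src C) (h₄ : boxV.tgt A' = boxV.src C'),
    boxV.comp (boxH.comp A A' h₁) (boxH.comp C C' h₂)
        (by rw [bot_comp, top_comp]; congr 1) =
      boxH.comp (boxV.comp A C h₃) (boxV.comp A' C' h₄)
        (by rw [right_comp, left_comp]; congr 1)

/-! ### Weak Hopf algebras -/

section WeakHopf

variable (k : Type*) {A : Type*} [CommRing k] [Ring A] [Algebra k A] [Coalgebra k A]

/-- The source map `ε_s(a) = (id ⊗ ε)((1 ⊗ a) Δ(1))`. -/
def weakSource (a : A) : A :=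
  TensorProduct.rid k A
    (LinearMap.lTensor A (Coalgebra.counit (R := k) (A := A))
      (((1 : A) ⊗ₜ[k] a) * Coalgebra.comul (R := k) (1 : A)))

/-- The target map `ε_t(a) = (ε ⊗ id)(Δ(1) (a ⊗ 1))`. -/
def weakTarget (a : A) : A :=
  TensorProduct.lid k A
    (LinearMap.rTensor A (Coalgebra.counit (R := k) (A := A))
      (Coalgebra.comul (R := k) (1 : A) * (a ⊗ₜ[k] (1 : A))))

/-- `S` is an antipode, in the sense of weak Hopf algebras:
`m(id ⊗ S)Δ = ε_t`, `m(S ⊗ id)Δ = ε_s` and `m²(S ⊗ id ⊗ S)Δ² = S`.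
(The three identities determine `S` uniquely.) -/
structure IsWeakAntipode (S : A →ₗ[k] A) : Prop where
  id_mul_antipode : ∀ a : A,
    LinearMap.mul' k A (TensorProduct.map LinearMap.id S (Coalgebra.comul (R := k) a)) =
      weakTarget k a
  antipode_mul_id : ∀ a : A,
    LinearMap.mul' k A (TensorProduct.map S LinearMap.id (Coalgebra.comul (R := k) a)) =
      weakSource k a
  antipode_mul_id_mul_antipode : ∀ a : A,
    LinearMap.mul' k A
      (TensorProduct.map
        (LinearMap.mul' k A ∘ₗ TensorProduct.map S LinearMap.id ∘ₗ Coalgebra.comul (R := k)) S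
        (Coalgebra.comul (R := k) a)) = S a

/-- Group-like elements of a weak Hopf algebra: invertible elements `g` with
`Δ(g) = Δ(1)(g ⊗ g) = (g ⊗ g)Δ(1)`. -/
structure IsWeakGroupLike (g : A) : Prop where
  isUnit : IsUnit g
  comul_eq : Coalgebra.comul (R := k) g = Coalgebra.comul (R := k) (1 : A) * (g ⊗ₜ[k] g)
  comul_eq' : Coalgebra.comul (R := k) g = (g ⊗ₜ[k] g) * Coalgebra.comul (R := k) (1 : A)

/-- A pivotal element with respect to the antipode `S`: a group-like element implementing
`S²` by conjugation, `S²(a) = g⁻¹ a g`. -/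
structure IsWeakPivotal (S : A →ₗ[k] A) (g : A) : Prop where
  isGroupLike : IsWeakGroupLike k g
  antipode_sq : ∀ a : A, S (S a) = Ring.inverse g * a * g

end WeakHopf

namespace DoubleGroupoid

variable {P H V B : Type*}

section Basic

variable (T : DoubleGroupoid P H V B)

/-- The vertices of a box: top left, top right, bottom left, bottom right. -/
def tl (A : B) : P := T.hor.src (T.boxV.src A)
def tr (A : B) : P := T.hor.tgt (T.boxV.src A)
def bl (A : B) : P := T.hor.src (T.boxV.tgt A)
def br (A : B) : P := T.hor.tgt (T.boxV.tgt A)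

/-- The total inverse `A⁻¹ = (A^h)^v` of a box. -/
def boxInv (A : B) : B := T.boxV.inv (T.boxH.inv A)

/-- `A` is the horizontal composite `X Y`. -/
def HFactor (A X Y : B) : Prop := ∃ h : T.boxH.tgt X = T.boxH.src Y, T.boxH.comp X Y h = A

theorem bl_of_HFactor {A X Y : B} (h : T.HFactor A X Y) : T.bl A = T.bl X := by
  obtain ⟨h, rfl⟩ := h
  simp only [bl, T.bot_comp, T.hor.src_comp]

theorem HFactor_assoc {A X Y Z : B} :
    (∃ W, T.HFactor A W Z ∧ T.HFactor W X Y) ↔ (∃ W, T.HFactor A X W ∧ T.HFactor W Y Z) := by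
  constructor
  · rintro ⟨W, ⟨h, rfl⟩, ⟨h', rfl⟩⟩
    have h2 : T.boxH.tgt Y = T.boxH.src Z := (T.boxH.tgt_comp _ _ _).symm.trans h
    exact ⟨T.boxH.comp Y Z h2, ⟨h'.trans (T.boxH.src_comp _ _ _).symm,
      (T.boxH.comp_assoc X Y Z h' h2).symm⟩, ⟨h2, rfl⟩⟩
  · rintro ⟨W, ⟨h, rfl⟩, ⟨h', rfl⟩⟩
    have h2 : T.boxH.tgt X = T.boxH.src Y := h.trans (T.boxH.src_comp _ _ _)
    exact ⟨T.boxH.comp X Y h2, ⟨(T.boxH.tgt_comp _ _ _).trans h',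
      T.boxH.comp_assoc X Y Z h2 h'⟩, ⟨h2, rfl⟩⟩

end Basic

/-- The normalization condition on `ϑ : P → kˣ`: for every vertical arrow `g` and horizontal
arrow `x` with `t(g) = r(x)`, the values `ϑ(bl(W))` over all boxes `W` with top side `x` and right
side `g` add up to `1`. -/
def IsNormalized [Fintype B] {k : Type*} [Field k] (T : DoubleGroupoid P H V B) (ϑ : P → kˣ) :
    Prop :=
  ∀ (g : V) (x : H), T.ver.src g = T.hor.tgt x →
    open Classical in
    ∑ W ∈ Finset.univ.filter (fun W : B => T.boxV.src W = x ∧ T.boxH.tgt W = g),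
      (ϑ (T.bl W) : k) = 1

/-- The vector space with basis the set of boxes `B`; it is a type synonym carrying the algebra
structure given by the vertical composition of `T` and the coalgebra structure
given by the horizontal composition of `T` deformed by `ϑ`. -/
def QuantumGroupoid {k : Type*} [Field k] (_T : DoubleGroupoid P H V B) (_ϑ : P → kˣ) : Type _ :=
  B →₀ k

namespace QuantumGroupoid

variable {k : Type*} [Field k] (T : DoubleGroupoid P H V B) (ϑ : P → kˣ)

noncomputable instance : AddCommGroup (T.QuantumGroupoid ϑ) :=
  inferInstanceAs (AddCommGroup (B →₀ k))

noncomputable instance : Module k (T.QuantumGroupoid ϑ) :=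
  inferInstanceAs (Module k (B →₀ k))

/-- The basis of the quantum groupoid given by the boxes. -/
noncomputable def boxBasis : Module.Basis B k (T.QuantumGroupoid ϑ) :=
  Module.Basis.ofRepr (LinearEquiv.refl k (B →₀ k))

open Classical in
/-- The product of two boxes: the vertical composite (`A` above `A'`) if it is defined, and `0`
otherwise. -/
noncomputable def boxMul (A A' : B) : T.QuantumGroupoid ϑ :=
  if h : T.boxV.tgt A = T.boxV.src A' then boxBasis T ϑ (T.boxV.comp A A' h) else 0

/-- The multiplication, as a bilinear map. -/
noncomputable def mulMap :
    T.QuantumGroupoid ϑ →ₗ[k] T.QuantumGroupoid ϑ →ₗ[k] T.QuantumGroupoid ϑ :=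
  (boxBasis T ϑ).constr k fun A => (boxBasis T ϑ).constr k fun A' => boxMul T ϑ A A'

theorem mulMap_box (A A' : B) :
    mulMap T ϑ (boxBasis T ϑ A) (boxBasis T ϑ A') = boxMul T ϑ A A' := by
  simp [mulMap, Module.Basis.constr_basis]

/-- The unit `∑ id x`, the sum over all horizontal arrows. -/
noncomputable def unit [Fintype H] : T.QuantumGroupoid ϑ :=
  ∑ x : H, boxBasis T ϑ (T.boxV.ident x)

theorem box_induction {p : T.QuantumGroupoid ϑ → Prop} (h0 : p 0)
    (hadd : ∀ a b, p a → p b → p (a + b)) (hsmul : ∀ (c : k) a, p a → p (c • a))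
    (hbox : ∀ A, p (boxBasis T ϑ A)) (a : T.QuantumGroupoid ϑ) : p a := by
  have ha : a ∈ Submodule.span k (Set.range (boxBasis T ϑ)) := by
    rw [(boxBasis T ϑ).span_eq]; trivial
  induction ha using Submodule.span_induction with
  | mem x hx => obtain ⟨A, rfl⟩ := hx; exact hbox A
  | zero => exact h0
  | add x y _ _ hx hy => exact hadd x y hx hy
  | smul c x _ hx => exact hsmul c x hx

theorem mulMap_assoc (a b c : T.QuantumGroupoid ϑ) :
    mulMap T ϑ (mulMap T ϑ a b) c = mulMap T ϑ a (mulMap T ϑ b c) := by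
  induction a using box_induction with
  | h0 => simp
  | hadd a a' h h' => simp [h, h']
  | hsmul r a h => simp [h]
  | hbox A =>
    induction b using box_induction with
    | h0 => simp
    | hadd a a' h h' => simp [h, h']
    | hsmul r a h => simp [h]
    | hbox A' =>
      induction c using box_induction with
      | h0 => simp
      | hadd a a' h h' => simp [h, h']
      | hsmul r a h => simp [h]
      | hbox A'' =>
        rw [mulMap_box, mulMap_box]
        unfold boxMul
        by_cases h₁ : T.boxV.tgt A = T.boxV.src A' <;>
          by_cases h₂ : T.boxV.tgt A' = T.boxV.src A'' <;>
          simp [h₁, h₂, mulMap_box, boxMul, T.boxV.tgt_comp, T.boxV.src_comp, T.boxV.comp_assoc]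

theorem unit_mulMap [Fintype H] (a : T.QuantumGroupoid ϑ) :
    mulMap T ϑ (unit T ϑ) a = a := by
  induction a using box_induction with
  | h0 => simp
  | hadd a a' h h' => simp [h, h']
  | hsmul r a h => simp [h]
  | hbox A =>
    rw [unit, map_sum, LinearMap.sum_apply, Finset.sum_eq_single (T.boxV.src A)]
    · rw [mulMap_box, boxMul, dif_pos (T.boxV.tgt_ident _), T.boxV.ident_comp]
    · intro x _ hx
      rw [mulMap_box, boxMul, dif_neg]
      rwa [T.boxV.tgt_ident]
    · simp

theorem mulMap_unit [Fintype H] (a : T.QuantumGroupoid ϑ) :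
    mulMap T ϑ a (unit T ϑ) = a := by
  induction a using box_induction with
  | h0 => simp
  | hadd a a' h h' => simp [h, h']
  | hsmul r a h => simp [h]
  | hbox A =>
    rw [unit, map_sum, Finset.sum_eq_single (T.boxV.tgt A)]
    · rw [mulMap_box, boxMul, dif_pos (T.boxV.src_ident _).symm, T.boxV.comp_ident]
    · intro x _ hx
      rw [mulMap_box, boxMul, dif_neg]
      rw [T.boxV.src_ident]
      exact hx.symm
    · simp

noncomputable instance [Fintype H] : Ring (T.QuantumGroupoid ϑ) :=
  { (inferInstance : AddCommGroup (T.QuantumGroupoid ϑ)) with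
    mul := fun a b => mulMap T ϑ a b
    one := unit T ϑ
    mul_assoc := mulMap_assoc T ϑ
    one_mul := unit_mulMap T ϑ
    mul_one := mulMap_unit T ϑ
    left_distrib := fun a b c => map_add (mulMap T ϑ a) b c
    right_distrib := fun a b c => by
      change mulMap T ϑ (a + b) c = mulMap T ϑ a c + mulMap T ϑ b c
      simp
    zero_mul := fun a => by
      change mulMap T ϑ 0 a = 0
      simp
    mul_zero := fun a => map_zero (mulMap T ϑ a) }

noncomputable instance [Fintype H] : Algebra k (T.QuantumGroupoid ϑ) :=
  Algebra.ofModule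
    (fun r a b => by
      change mulMap T ϑ (r • a) b = r • mulMap T ϑ a b
      simp)
    (fun r a b => map_smul (mulMap T ϑ a) r b)

open Classical in
/-- `Δ(A) = ∑ ϑ(bl(Y)) X ⊗ Y`, the sum over all horizontal factorizations `A = X Y`. -/
noncomputable def comulMap [Fintype B] :
    T.QuantumGroupoid ϑ →ₗ[k] T.QuantumGroupoid ϑ ⊗[k] T.QuantumGroupoid ϑ :=
  (boxBasis T ϑ).constr k fun A =>
    ∑ p ∈ Finset.univ.filter (fun p : B × B => T.HFactor A p.1 p.2),
      (ϑ (T.bl p.2) : k) • (boxBasis T ϑ p.1 ⊗ₜ[k] boxBasis T ϑ p.2)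

open Classical in
/-- `ε(A) = ϑ(bl(A))⁻¹` if `A` is a horizontal identity (an identity box on a vertical arrow),
and `ε(A) = 0` otherwise. -/
noncomputable def counitMap : T.QuantumGroupoid ϑ →ₗ[k] k :=
  (boxBasis T ϑ).constr k fun A =>
    if A ∈ Set.range T.boxH.ident then ((ϑ (T.bl A) : k))⁻¹ else 0

open Classical in
theorem comulMap_box [Fintype B] (A : B) : comulMap T ϑ (boxBasis T ϑ A) =
    ∑ p ∈ Finset.univ.filter (fun p : B × B => T.HFactor A p.1 p.2),
      (ϑ (T.bl p.2) : k) • (boxBasis T ϑ p.1 ⊗ₜ[k] boxBasis T ϑ p.2) := by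
  simp only [comulMap, Module.Basis.constr_basis]

open Classical in
theorem counitMap_box (A : B) : counitMap T ϑ (boxBasis T ϑ A) =
    if A ∈ Set.range T.boxH.ident then ((ϑ (T.bl A) : k))⁻¹ else 0 := by
  simp only [counitMap, Module.Basis.constr_basis]

theorem comul_coassoc [Fintype B] :
    (TensorProduct.assoc k (T.QuantumGroupoid ϑ) (T.QuantumGroupoid ϑ) (T.QuantumGroupoid ϑ) :
        _ →ₗ[k] _) ∘ₗ (comulMap T ϑ).rTensor _ ∘ₗ comulMap T ϑ =
      (comulMap T ϑ).lTensor _ ∘ₗ comulMap T ϑ := by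
  classical
  refine (boxBasis T ϑ).ext fun A => ?_
  simp only [LinearMap.comp_apply, comulMap_box, map_sum, map_smul, LinearMap.rTensor_tmul,
    LinearMap.lTensor_tmul, TensorProduct.sum_tmul, TensorProduct.tmul_sum,
    ← TensorProduct.smul_tmul', TensorProduct.tmul_smul, Finset.smul_sum, LinearEquiv.coe_coe,
    TensorProduct.assoc_tmul]
  rw [Finset.sum_sigma', Finset.sum_sigma']
  refine Finset.sum_bij'
    (fun q _ => ⟨(q.2.1, if h : T.boxH.tgt q.2.2 = T.boxH.src q.1.2 then
      T.boxH.comp q.2.2 q.1.2 h else q.2.2), (q.2.2, q.1.2)⟩)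
    (fun q _ => ⟨(if h : T.boxH.tgt q.1.1 = T.boxH.src q.2.1 then
      T.boxH.comp q.1.1 q.2.1 h else q.1.1, q.2.2), (q.1.1, q.2.1)⟩) ?_ ?_ ?_ ?_ ?_
  · rintro ⟨⟨W, Z⟩, ⟨X, Y⟩⟩ hq
    simp only [Finset.mem_sigma, Finset.mem_filter, Finset.mem_univ, true_and] at hq ⊢
    obtain ⟨W', h, h', rfl⟩ := (T.HFactor_assoc).1 ⟨W, hq⟩
    rw [dif_pos h']
    exact ⟨h, h', rfl⟩
  · rintro ⟨⟨X, W⟩, ⟨Y, Z⟩⟩ hq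
    simp only [Finset.mem_sigma, Finset.mem_filter, Finset.mem_univ, true_and] at hq ⊢
    obtain ⟨W', h, h', rfl⟩ := (T.HFactor_assoc).2 ⟨W, hq⟩
    rw [dif_pos h']
    exact ⟨h, h', rfl⟩
  · rintro ⟨⟨W, Z⟩, ⟨X, Y⟩⟩ hq
    simp only [Finset.mem_sigma, Finset.mem_filter, Finset.mem_univ, true_and] at hq ⊢
    obtain ⟨h, h', rfl⟩ := hq
    rw [dif_pos h']
  · rintro ⟨⟨X, W⟩, ⟨Y, Z⟩⟩ hq
    simp only [Finset.mem_sigma, Finset.mem_filter, Finset.mem_univ, true_and] at hq ⊢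
    obtain ⟨h, h', rfl⟩ := hq
    rw [dif_pos h']
  · rintro ⟨⟨W, Z⟩, ⟨X, Y⟩⟩ hq
    simp only [Finset.mem_sigma, Finset.mem_filter, Finset.mem_univ, true_and] at hq ⊢
    obtain ⟨W', h, h', rfl⟩ := (T.HFactor_assoc).1 ⟨W, hq⟩
    rw [dif_pos h', T.bl_of_HFactor ⟨h', rfl⟩, smul_smul, smul_smul,
      mul_comm (ϑ (T.bl Y) : k)]

theorem counit_rTensor [Fintype B] :
    (counitMap T ϑ).rTensor _ ∘ₗ comulMap T ϑ = TensorProduct.mk k _ _ 1 := by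
  classical
  refine (boxBasis T ϑ).ext fun A => ?_
  simp only [LinearMap.comp_apply, comulMap_box, map_sum, map_smul, LinearMap.rTensor_tmul,
    counitMap_box]
  rw [Finset.sum_eq_single (T.boxH.ident (T.boxH.src A), A)]
  · rw [if_pos ⟨_, rfl⟩, ← T.bl_of_HFactor ⟨T.boxH.tgt_ident _, T.boxH.ident_comp A⟩,
      TensorProduct.smul_tmul', smul_eq_mul, mul_inv_cancel₀ (Units.ne_zero _)]
    rfl
  · rintro ⟨X, Y⟩ hq hne
    simp only [Finset.mem_filter, Finset.mem_univ, true_and] at hq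
    rw [if_neg, TensorProduct.zero_tmul, smul_zero]
    rintro ⟨g, rfl⟩
    obtain ⟨h, rfl⟩ := hq
    apply hne
    rw [T.boxH.tgt_ident] at h
    subst h
    simp [T.boxH.ident_comp]
  · intro h
    exact absurd (Finset.mem_filter.2 ⟨Finset.mem_univ _,
      ⟨T.boxH.tgt_ident _, T.boxH.ident_comp A⟩⟩) h

theorem counit_lTensor [Fintype B] :
    (counitMap T ϑ).lTensor _ ∘ₗ comulMap T ϑ = (TensorProduct.mk k _ _).flip 1 := by
  classical
  refine (boxBasis T ϑ).ext fun A => ?_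
  simp only [LinearMap.comp_apply, comulMap_box, map_sum, map_smul, LinearMap.lTensor_tmul,
    counitMap_box]
  rw [Finset.sum_eq_single (A, T.boxH.ident (T.boxH.tgt A))]
  · rw [if_pos ⟨_, rfl⟩, ← TensorProduct.tmul_smul, smul_eq_mul,
      mul_inv_cancel₀ (Units.ne_zero _)]
    rfl
  · rintro ⟨X, Y⟩ hq hne
    simp only [Finset.mem_filter, Finset.mem_univ, true_and] at hq
    rw [if_neg, TensorProduct.tmul_zero, smul_zero]
    rintro ⟨g, rfl⟩
    obtain ⟨h, rfl⟩ := hq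
    apply hne
    rw [T.boxH.src_ident] at h
    subst h
    simp [T.boxH.comp_ident]
  · intro h
    exact absurd (Finset.mem_filter.2 ⟨Finset.mem_univ _,
      ⟨(T.boxH.src_ident _).symm, T.boxH.comp_ident A⟩⟩) h

noncomputable instance [Fintype B] : Coalgebra k (T.QuantumGroupoid ϑ) where
  comul := comulMap T ϑ
  counit := counitMap T ϑ
  coassoc := comul_coassoc T ϑ
  rTensor_counit_comp_comul := counit_rTensor T ϑ
  lTensor_counit_comp_comul := counit_lTensor T ϑ

/-- The linear map `A ↦ (ϑ(tr(A)) / ϑ(br(A))) A⁻¹`. -/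
noncomputable def antipode : T.QuantumGroupoid ϑ →ₗ[k] T.QuantumGroupoid ϑ :=
  (boxBasis T ϑ).constr k fun A =>
    ((ϑ (T.tr A) : k) / (ϑ (T.br A) : k)) • boxBasis T ϑ (T.boxInv A)

/-- The element `G = ∑ (ϑ(l(x)) / ϑ(r(x))) id x`, the sum over all horizontal arrows `x`. -/
noncomputable def pivotalElement [Fintype H] : T.QuantumGroupoid ϑ :=
  ∑ x : H, ((ϑ (T.hor.src x) : k) / (ϑ (T.hor.tgt x) : k)) • boxBasis T ϑ (T.boxV.ident x)

end QuantumGroupoid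

end DoubleGroupoid

/-!
Everything is a computation on the basis of boxes, made possible by two facts.

First, a horizontal factorization `A = XY` is determined by `X`, which can be any box with left
side `l(A)`; so the boxes `X` with a given top side are, up to horizontal inversion, those over which
the normalization condition sums. A sum over the factorizations of `A` that involves `X` only through
the weight `ϑ(br(X)) = ϑ(bl(Y))` and the top side of `X` therefore collapses to an unweighted sum over
horizontal arrows (`IsNormalized.sum_top`). Applying the normalization condition to the vertical
inverse of `Y` instead gives the same for the weight `ϑ(tl(Y))` and the bottom side of `Y`
(`IsNormalized.sum_bot`).

Second, if `A = XY`, the product of `X` and `Y⁻¹` vanishes unless `b(A)` is an identity, and then it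
is the horizontal composite `E (id t(X))`, where `E` is the identity box on `l(A)` above `A⁻¹`
(`IsTargetBox.exists_comp`). This is one application of the interchange law. By the first fact
`m(id ⊗ S)Δ(A)` is a multiple of the sum of the boxes `E (id x)`. On the other side,
`ε_t(A)` is a sum over the factorizations `id x = XY` for which `X` above `A` is a horizontal
identity, which forces `X = E^h` and hence `Y = E (id x)` (`IsTargetBox.isComp_identH_iff`). The
computation of `ε_s(A)` is the mirror image, with the box `E` formed by `A⁻¹` above the identity box
on `r(A)`. For the third identity of the antipode, if `A = XY` and `t(X)` is an identity then
exactly one summand of `ε_s(X)` lies above `Y⁻¹`, and their composite is `A⁻¹`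
(`IsSourceBox.isComp_boxInv`), so that the first fact applies once more.

Multiplication by the pivotal element rescales each box by the quotient of the values of `ϑ` at two
adjacent vertices. Group-likeness holds because these quotients telescope along `A = XY`. The square
of the antipode rescales `A` by `ϑ(tr) ϑ(bl) / (ϑ(br) ϑ(tl))`, which is also the factor by
which conjugation rescales it.
-/

/-! ### Composition in a groupoid as a relation -/

namespace ArrowGroupoid

variable {Ob Ar : Type*} (G : ArrowGroupoid Ob Ar)

/-- `a` is the composite of `f` and `g`; in particular `f` and `g` are composable. As a relation,
composition can be rewritten without transporting the proof of composability. -/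
def IsComp (a f g : Ar) : Prop := ∃ h : G.tgt f = G.src g, G.comp f g h = a

variable {G}

theorem exists_isComp {f g : Ar} (h : G.tgt f = G.src g) : ∃ a, G.IsComp a f g := ⟨_, h, rfl⟩

theorem IsComp.src_eq {a f g : Ar} (h : G.IsComp a f g) : G.src a = G.src f := by
  obtain ⟨h, rfl⟩ := h
  exact G.src_comp f g h

theorem IsComp.tgt_eq {a f g : Ar} (h : G.IsComp a f g) : G.tgt a = G.tgt g := by
  obtain ⟨h, rfl⟩ := h
  exact G.tgt_comp f g h

theorem IsComp.unique {a a' f g : Ar} (h : G.IsComp a f g) (h' : G.IsComp a' f g) : a = a' := by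
  obtain ⟨_, rfl⟩ := h
  obtain ⟨_, rfl⟩ := h'
  rfl

variable (G) in
theorem isComp_ident_left (f : Ar) : G.IsComp f (G.ident (G.src f)) f := ⟨_, G.ident_comp f⟩

variable (G) in
theorem isComp_ident_right (f : Ar) : G.IsComp f f (G.ident (G.tgt f)) := ⟨_, G.comp_ident f⟩

variable (G) in
theorem isComp_inv_right (f : Ar) : G.IsComp (G.ident (G.src f)) f (G.inv f) := ⟨_, G.comp_inv f⟩

variable (G) in
theorem isComp_inv_left (f : Ar) : G.IsComp (G.ident (G.tgt f)) (G.inv f) f := ⟨_, G.inv_comp f⟩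

theorem IsComp.assoc {a b c f g e : Ar} (hc : G.IsComp c a e) (ha : G.IsComp a f g)
    (hb : G.IsComp b g e) : G.IsComp c f b := by
  obtain ⟨h, rfl⟩ := ha
  obtain ⟨h', rfl⟩ := hb
  obtain ⟨_, rfl⟩ := hc
  exact ⟨_, (G.comp_assoc f g e h h').symm⟩

theorem IsComp.assoc' {a b c f g e : Ar} (hc : G.IsComp c f b) (hb : G.IsComp b g e)
    (ha : G.IsComp a f g) : G.IsComp c a e := by
  obtain ⟨h, rfl⟩ := ha
  obtain ⟨h', rfl⟩ := hb
  obtain ⟨_, rfl⟩ := hc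
  exact ⟨_, G.comp_assoc f g e h h'⟩

theorem IsComp.inv_comp {a f g : Ar} (h : G.IsComp a f g) : G.IsComp g (G.inv f) a := by
  refine IsComp.assoc (G.isComp_ident_left g) ?_ h
  rw [← h.1]
  exact G.isComp_inv_left f

theorem IsComp.comp_inv {a f g : Ar} (h : G.IsComp a f g) : G.IsComp f a (G.inv g) := by
  refine IsComp.assoc' (G.isComp_ident_right f) ?_ h
  rw [h.1]
  exact G.isComp_inv_right g

theorem IsComp.eq_inv {p : Ob} {f g : Ar} (h : G.IsComp (G.ident p) f g) : f = G.inv g := by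
  have hg : p = G.src (G.inv g) := by
    rw [G.src_inv, ← h.tgt_eq, G.tgt_ident]
  subst hg
  exact h.comp_inv.unique (G.isComp_ident_left _)

theorem inv_inv (f : Ar) : G.inv (G.inv f) = f := (G.isComp_inv_right f).eq_inv.symm

theorem inv_ident (p : Ob) : G.inv (G.ident p) = G.ident p := by
  have h := G.isComp_ident_left (G.ident p)
  rw [G.src_ident] at h
  exact h.eq_inv.symm

theorem IsComp.inv {a f g : Ar} (h : G.IsComp a f g) : G.IsComp (G.inv a) (G.inv g) (G.inv f) := by
  simpa [inv_inv] using h.inv_comp.comp_inv.inv_comp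

theorem ident_injective : Function.Injective G.ident := fun p q h => by
  rw [← G.src_ident p, h, G.src_ident]

theorem inv_injective : Function.Injective G.inv := fun f g h => by
  rw [← G.inv_inv f, h, G.inv_inv]

theorem IsComp.eq_of_ident_left {p : Ob} {a f : Ar} (h : G.IsComp a (G.ident p) f) : a = f := by
  have hp : p = G.src f := by rw [← h.1, G.tgt_ident]
  subst hp
  exact h.unique (G.isComp_ident_left f)

theorem IsComp.eq_of_ident_right {p : Ob} {a f : Ar} (h : G.IsComp a f (G.ident p)) : a = f := by
  have hp : p = G.tgt f := by rw [h.1, G.src_ident]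
  subst hp
  exact h.unique (G.isComp_ident_right f)

end ArrowGroupoid

/-! ### Inverses in a double groupoid -/

namespace DoubleGroupoid

variable {P H V B : Type*} (T : DoubleGroupoid P H V B)

/-- The double groupoid with the two directions exchanged. -/
def transpose : DoubleGroupoid P V H B where
  hor := T.ver
  ver := T.hor
  boxH := T.boxV
  boxV := T.boxH
  corner_tl A := (T.corner_tl A).symm
  corner_tr A := (T.corner_bl A).symm
  corner_bl A := (T.corner_tr A).symm
  corner_br A := (T.corner_br A).symm
  top_comp := T.left_comp
  bot_comp := T.right_comp
  left_comp := T.top_comp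
  right_comp := T.bot_comp
  top_ident := T.left_ident
  bot_ident := T.right_ident
  left_ident := T.top_ident
  right_ident := T.bot_ident
  ident_ident p := (T.ident_ident p).symm
  identV_comp := T.identH_comp
  identH_comp := T.identV_comp
  interchange A A' C C' h₁ h₂ h₃ h₄ := (T.interchange A C A' C' h₃ h₄ h₁ h₂).symm

variable {T}

theorem top_isComp {A X Y : B} (h : T.boxH.IsComp A X Y) :
    T.hor.IsComp (T.boxV.src A) (T.boxV.src X) (T.boxV.src Y) := by
  obtain ⟨h, rfl⟩ := h
  exact ⟨_, (T.top_comp X Y h).symm⟩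

theorem bot_isComp {A X Y : B} (h : T.boxH.IsComp A X Y) :
    T.hor.IsComp (T.boxV.tgt A) (T.boxV.tgt X) (T.boxV.tgt Y) := by
  obtain ⟨h, rfl⟩ := h
  exact ⟨_, (T.bot_comp X Y h).symm⟩

theorem left_isComp {A X Y : B} (h : T.boxV.IsComp A X Y) :
    T.ver.IsComp (T.boxH.src A) (T.boxH.src X) (T.boxH.src Y) := T.transpose.top_isComp h

theorem right_isComp {A X Y : B} (h : T.boxV.IsComp A X Y) :
    T.ver.IsComp (T.boxH.tgt A) (T.boxH.tgt X) (T.boxH.tgt Y) := T.transpose.bot_isComp h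

theorem identV_isComp {a x y : H} (h : T.hor.IsComp a x y) :
    T.boxH.IsComp (T.boxV.ident a) (T.boxV.ident x) (T.boxV.ident y) := by
  obtain ⟨h, rfl⟩ := h
  exact ⟨_, (T.identV_comp x y h).symm⟩

theorem identH_isComp {a f g : V} (h : T.ver.IsComp a f g) :
    T.boxV.IsComp (T.boxH.ident a) (T.boxH.ident f) (T.boxH.ident g) :=
  T.transpose.identV_isComp h

/-- The interchange law: if the rows of the array with rows `A A'` and `C C'` compose to `X` and
`Y`, and its columns to `L` and `R`, then the vertical composite of the rows is the horizontal
composite of the columns. -/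
theorem interchange_isComp {A A' C C' X Y L R Z : B} (hX : T.boxH.IsComp X A A')
    (hY : T.boxH.IsComp Y C C') (hL : T.boxV.IsComp L A C) (hR : T.boxV.IsComp R A' C')
    (hZ : T.boxH.IsComp Z L R) : T.boxV.IsComp Z X Y := by
  obtain ⟨h₁, rfl⟩ := hX
  obtain ⟨h₂, rfl⟩ := hY
  obtain ⟨h₃, rfl⟩ := hL
  obtain ⟨h₄, rfl⟩ := hR
  obtain ⟨_, rfl⟩ := hZ
  exact ⟨_, T.interchange A A' C C' h₁ h₂ h₃ h₄⟩

/-- The converse form of the interchange law, where the vertical composite is known to exist. -/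
theorem interchange_isComp' {A A' C C' X Y L R Z : B} (hX : T.boxH.IsComp X A A')
    (hY : T.boxH.IsComp Y C C') (hL : T.boxV.IsComp L A C) (hR : T.boxV.IsComp R A' C')
    (hZ : T.boxV.IsComp Z X Y) : T.boxH.IsComp Z L R :=
  T.transpose.interchange_isComp hL hR hX hY hZ

variable (T)

theorem top_invH (A : B) : T.boxV.src (T.boxH.inv A) = T.hor.inv (T.boxV.src A) := by
  have h := top_isComp (T.boxH.isComp_inv_left A)
  rw [T.top_ident] at h
  exact h.eq_inv

theorem bot_invH (A : B) : T.boxV.tgt (T.boxH.inv A) = T.hor.inv (T.boxV.tgt A) := by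
  have h := bot_isComp (T.boxH.isComp_inv_left A)
  rw [T.bot_ident] at h
  exact h.eq_inv

theorem left_invV (A : B) : T.boxH.src (T.boxV.inv A) = T.ver.inv (T.boxH.src A) :=
  T.transpose.top_invH A

theorem right_invV (A : B) : T.boxH.tgt (T.boxV.inv A) = T.ver.inv (T.boxH.tgt A) :=
  T.transpose.bot_invH A

theorem invH_identV (x : H) : T.boxH.inv (T.boxV.ident x) = T.boxV.ident (T.hor.inv x) := by
  have h := identV_isComp (T.hor.isComp_inv_left x)
  rw [T.ident_ident] at h
  exact h.eq_inv.symm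

theorem invV_identH (g : V) : T.boxV.inv (T.boxH.ident g) = T.boxH.ident (T.ver.inv g) :=
  T.transpose.invH_identV g

variable {T}

theorem invH_isComp {A X Y : B} (h : T.boxV.IsComp A X Y) :
    T.boxV.IsComp (T.boxH.inv A) (T.boxH.inv X) (T.boxH.inv Y) := by
  have hcomp : T.boxV.tgt (T.boxH.inv X) = T.boxV.src (T.boxH.inv Y) := by
    rw [bot_invH, top_invH, h.1]
  obtain ⟨Z, hZ⟩ := ArrowGroupoid.exists_isComp hcomp
  obtain ⟨_, hY⟩ := h
  have hA : T.boxV.IsComp A X Y := ⟨_, hY⟩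
  have key := interchange_isComp' (T.boxH.isComp_inv_left X) (T.boxH.isComp_inv_left Y) hZ hA
    (identH_isComp (right_isComp hA))
  rwa [key.eq_inv] at hZ

variable (T)

theorem invH_invV (A : B) : T.boxH.inv (T.boxV.inv A) = T.boxV.inv (T.boxH.inv A) := by
  have h := invH_isComp (T.boxV.isComp_inv_left A)
  rw [invH_identV] at h
  exact h.eq_inv

theorem boxInv_boxInv (A : B) : T.boxInv (T.boxInv A) = A := by
  simp only [boxInv, invH_invV, ArrowGroupoid.inv_inv]

variable {T}

theorem invV_isComp {A X Y : B} (h : T.boxH.IsComp A X Y) :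
    T.boxH.IsComp (T.boxV.inv A) (T.boxV.inv X) (T.boxV.inv Y) := T.transpose.invH_isComp h

theorem boxInv_isComp {A X Y : B} (h : T.boxH.IsComp A X Y) :
    T.boxH.IsComp (T.boxInv A) (T.boxInv Y) (T.boxInv X) := invV_isComp h.inv

variable (T)

theorem top_boxInv (A : B) : T.boxV.src (T.boxInv A) = T.hor.inv (T.boxV.tgt A) := by
  rw [boxInv, T.boxV.src_inv, bot_invH]

theorem bot_boxInv (A : B) : T.boxV.tgt (T.boxInv A) = T.hor.inv (T.boxV.src A) := by
  rw [boxInv, T.boxV.tgt_inv, top_invH]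

theorem left_boxInv (A : B) : T.boxH.src (T.boxInv A) = T.ver.inv (T.boxH.tgt A) := by
  rw [boxInv, left_invV, T.boxH.src_inv]

theorem right_boxInv (A : B) : T.boxH.tgt (T.boxInv A) = T.ver.inv (T.boxH.src A) := by
  rw [boxInv, right_invV, T.boxH.tgt_inv]

end DoubleGroupoid

namespace DoubleGroupoid

variable {P H V B : Type*} {T : DoubleGroupoid P H V B}

/-! ### The boxes underlying the source and target maps -/

theorem tl_eq_of_isComp {A X Y : B} (h : T.boxH.IsComp A X Y) : T.tl A = T.tl X :=
  (top_isComp h).src_eq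

theorem tr_eq_of_isComp {A X Y : B} (h : T.boxH.IsComp A X Y) : T.tr A = T.tr Y :=
  (top_isComp h).tgt_eq

theorem bl_eq_of_isComp {A X Y : B} (h : T.boxH.IsComp A X Y) : T.bl A = T.bl X :=
  (bot_isComp h).src_eq

theorem br_eq_of_isComp {A X Y : B} (h : T.boxH.IsComp A X Y) : T.br A = T.br Y :=
  (bot_isComp h).tgt_eq

theorem br_eq_bl_of_isComp {A X Y : B} (h : T.boxH.IsComp A X Y) : T.br X = T.bl Y :=
  (bot_isComp h).1

theorem tr_eq_tl_of_isComp {A X Y : B} (h : T.boxH.IsComp A X Y) : T.tr X = T.tl Y :=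
  (top_isComp h).1

/-- `E` is the vertical composite of the identity box on `l(A)` with `A⁻¹` below it, which exists
precisely if the bottom side of `A` is an identity. -/
def IsTargetBox (T : DoubleGroupoid P H V B) (A E : B) : Prop :=
  T.boxV.IsComp E (T.boxH.ident (T.boxH.src A)) (T.boxInv A)

/-- `E` is the vertical composite of `A⁻¹` with the identity box on `r(A)` below it, which exists
precisely if the top side of `A` is an identity. -/
def IsSourceBox (T : DoubleGroupoid P H V B) (A E : B) : Prop :=
  T.boxV.IsComp E (T.boxInv A) (T.boxH.ident (T.boxH.tgt A))

theorem exists_isTargetBox {A : B} {p : P} (hA : T.boxV.tgt A = T.hor.ident p) :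
    ∃ E, T.IsTargetBox A E := by
  apply ArrowGroupoid.exists_isComp
  rw [T.bot_ident, top_boxInv, ← T.corner_bl, hA, T.hor.src_ident, ArrowGroupoid.inv_ident]

theorem exists_isSourceBox {A : B} {p : P} (hA : T.boxV.src A = T.hor.ident p) :
    ∃ E, T.IsSourceBox A E := by
  apply ArrowGroupoid.exists_isComp
  rw [T.top_ident, bot_boxInv, ← T.corner_tr, hA, T.hor.tgt_ident, ArrowGroupoid.inv_ident]

theorem IsTargetBox.right_eq {A E : B} (h : T.IsTargetBox A E) :
    T.boxH.tgt E = T.ver.ident (T.tl A) := by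
  have h' := right_isComp h
  rw [T.boxH.tgt_ident, right_boxInv] at h'
  exact (h'.unique (T.ver.isComp_inv_right _)).trans (by rw [tl, T.corner_tl])

theorem IsSourceBox.left_eq {A E : B} (h : T.IsSourceBox A E) :
    T.boxH.src E = T.ver.ident (T.br A) := by
  have h' := left_isComp h
  rw [T.boxH.src_ident, left_boxInv] at h'
  exact (h'.unique (T.ver.isComp_inv_left _)).trans (by rw [br, T.corner_br])

theorem IsSourceBox.bot_eq {A E : B} (h : T.IsSourceBox A E) :
    T.boxV.tgt E = T.hor.ident (T.br A) := by
  rw [ArrowGroupoid.IsComp.tgt_eq h, T.bot_ident, br, T.corner_br]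

/-- If `A = XY` and `b(A)` is an identity, then `X` lies above `Y⁻¹`, and their vertical composite
depends only on `A` and the top side of `X`. -/
theorem IsTargetBox.exists_comp {A E X Y : B} {p : P} (hE : T.IsTargetBox A E)
    (hA : T.boxV.tgt A = T.hor.ident p) (h : T.boxH.IsComp A X Y) :
    ∃ Z, T.boxV.IsComp Z X (T.boxInv Y) ∧ T.boxH.IsComp Z E (T.boxV.ident (T.boxV.src X)) := by
  have hb := bot_isComp h
  rw [hA] at hb
  obtain ⟨Z, hZ⟩ := ArrowGroupoid.exists_isComp (G := T.boxV) (f := X) (g := T.boxInv Y)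
    (by rw [top_boxInv]; exact hb.eq_inv)
  refine ⟨Z, hZ, ?_⟩
  have hY := (boxInv_isComp h).comp_inv
  rw [boxInv, boxInv, boxInv, ← invH_invV, ← invH_invV, ← invH_invV,
    ArrowGroupoid.inv_inv, invH_invV, invH_invV] at hY
  rw [IsTargetBox, h.src_eq] at hE
  exact interchange_isComp' (T.boxH.isComp_ident_left X) hY hE (T.boxV.isComp_inv_right X) hZ

/-- If `A = XY` and `t(A)` is an identity, then `X⁻¹` lies above `Y`, and their vertical composite
depends only on `A` and the bottom side of `Y`. -/
theorem IsSourceBox.exists_comp {A E X Y : B} {p : P} (hE : T.IsSourceBox A E)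
    (hA : T.boxV.src A = T.hor.ident p) (h : T.boxH.IsComp A X Y) :
    ∃ Z, T.boxV.IsComp Z (T.boxInv X) Y ∧ T.boxH.IsComp Z (T.boxV.ident (T.boxV.tgt Y)) E := by
  have ht := top_isComp h
  rw [hA] at ht
  obtain ⟨Z, hZ⟩ := ArrowGroupoid.exists_isComp (G := T.boxV) (f := T.boxInv X) (g := Y)
    (by rw [bot_boxInv, ht.eq_inv, ArrowGroupoid.inv_inv])
  refine ⟨Z, hZ, ?_⟩
  have hX := (boxInv_isComp h).inv_comp
  rw [show T.boxInv Y = T.boxH.inv (T.boxV.inv Y) from (T.invH_invV Y).symm,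
    ArrowGroupoid.inv_inv] at hX
  rw [IsSourceBox, h.tgt_eq] at hE
  exact interchange_isComp' hX (T.boxH.isComp_ident_right Y) (T.boxV.isComp_inv_left Y) hE hZ

/-- Among the boxes `X` whose left side is an identity, only `E^h` lies above `A` with vertical
composite a horizontal identity. -/
theorem IsTargetBox.isComp_identH_iff {A E X : B} {q : P} (hE : T.IsTargetBox A E)
    (hX : T.boxH.src X = T.ver.ident q) :
    (∃ g, T.boxV.IsComp (T.boxH.ident g) X A) ↔ X = T.boxH.inv E := by
  constructor
  · rintro ⟨g, h⟩
    have hg := left_isComp h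
    rw [T.boxH.src_ident, hX] at hg
    obtain rfl := hg.eq_of_ident_left
    have h' := (invH_isComp h).comp_inv
    rw [ArrowGroupoid.inv_ident] at h'
    rw [hE.unique h', ArrowGroupoid.inv_inv]
  · rintro rfl
    have h := ArrowGroupoid.IsComp.comp_inv hE
    rw [boxInv, ArrowGroupoid.inv_inv] at h
    have h' := invH_isComp h
    rw [ArrowGroupoid.inv_inv, ArrowGroupoid.inv_ident] at h'
    exact ⟨_, h'⟩

/-- Among the boxes `Y` whose right side is an identity, only `E^h` lies below `A` with vertical
composite a horizontal identity. -/
theorem IsSourceBox.isComp_identH_iff {A E Y : B} {q : P} (hE : T.IsSourceBox A E)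
    (hY : T.boxH.tgt Y = T.ver.ident q) :
    (∃ g, T.boxV.IsComp (T.boxH.ident g) A Y) ↔ Y = T.boxH.inv E := by
  constructor
  · rintro ⟨g, h⟩
    have hg := right_isComp h
    rw [T.boxH.tgt_ident, hY] at hg
    obtain rfl := hg.eq_of_ident_right
    have h' := (invH_isComp h).inv_comp
    rw [ArrowGroupoid.inv_ident] at h'
    rw [hE.unique h', ArrowGroupoid.inv_inv]
  · rintro rfl
    have h := ArrowGroupoid.IsComp.inv_comp hE
    rw [boxInv, ArrowGroupoid.inv_inv] at h
    have h' := invH_isComp h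
    rw [ArrowGroupoid.inv_inv, ArrowGroupoid.inv_ident] at h'
    exact ⟨_, h'⟩

/-- The box identity behind `S * id * S = S`: if `A = XY`, and `Z` is a summand `id_x E` of
`ε_s(X)` lying above `Y⁻¹`, then the vertical composite of `Z` and `Y⁻¹` is `A⁻¹`. -/
theorem IsSourceBox.isComp_boxInv {A E X Y Z : B} (hE : T.IsSourceBox X E)
    (h : T.boxH.IsComp A X Y)
    (hZ : T.boxH.IsComp Z (T.boxV.ident (T.hor.inv (T.boxV.tgt Y))) E) :
    T.boxV.IsComp (T.boxInv A) Z (T.boxInv Y) := by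
  -- `Y⁻¹` is followed by the identity box on its right side, so that the two columns are
  -- `id` above `Y⁻¹`, and `E` above the inverse of the identity box which `E` ends with.
  have hY : T.boxH.IsComp (T.boxInv Y) (T.boxInv Y)
      (T.boxV.inv (T.boxH.ident (T.boxH.tgt X))) := by
    have := T.boxH.isComp_ident_right (T.boxInv Y)
    rwa [right_boxInv, ← h.1, ← invV_identH] at this
  have hL := T.boxV.isComp_ident_left (T.boxInv Y)
  rw [top_boxInv] at hL
  exact interchange_isComp hZ hY hL (ArrowGroupoid.IsComp.comp_inv hE) (boxInv_isComp h)

end DoubleGroupoid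

namespace DoubleGroupoid

variable {P H V B : Type*} {T : DoubleGroupoid P H V B}

/-! ### Sums over horizontal factorizations -/

section Sums

variable {k M : Type*} [Field k] [AddCommGroup M] [Module k M] [Fintype H] [Fintype B]
  {ϑ : P → kˣ}

open Classical in
/-- Since a factorization `A = XY` is determined by `X`, which can be any box with left side
`l(A)`, the normalization condition collapses a sum that depends on the factorization only through
the weight `ϑ(br(X))` and the top side of `X`. -/
theorem IsNormalized.sum_top (hϑ : T.IsNormalized ϑ) (A : B) (F : H → M) :
    ∑ p ∈ Finset.univ.filter (fun p : B × B => T.HFactor A p.1 p.2),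
      (ϑ (T.br p.1) : k) • F (T.boxV.src p.1) =
    ∑ x ∈ Finset.univ.filter (fun x : H => T.hor.src x = T.tl A), F x := by
  rw [← Finset.sum_fiberwise_of_maps_to (g := fun p : B × B => T.boxV.src p.1)
    (t := Finset.univ.filter (fun x : H => T.hor.src x = T.tl A))]
  swap
  · intro p hp
    simp only [Finset.mem_filter, Finset.mem_univ, true_and] at hp ⊢
    exact (tl_eq_of_isComp hp).symm
  refine Finset.sum_congr rfl fun x hx => ?_
  simp only [Finset.mem_filter, Finset.mem_univ, true_and] at hx
  have key := hϑ (T.boxH.src A) (T.hor.inv x) (by rw [T.hor.tgt_inv, hx, tl, T.corner_tl])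
  rw [← one_smul k (F x), ← key, Finset.sum_smul, Finset.filter_filter]
  refine Finset.sum_bij (fun p _ => T.boxH.inv p.1) ?_ ?_ ?_ ?_
  · rintro ⟨X, Y⟩ h
    simp only [Finset.mem_filter, Finset.mem_univ, true_and] at h ⊢
    rw [top_invH, h.2, T.boxH.tgt_inv]
    exact ⟨rfl, (ArrowGroupoid.IsComp.src_eq h.1).symm⟩
  · rintro ⟨X, Y⟩ h ⟨X', Y'⟩ h' e
    simp only [Finset.mem_filter, Finset.mem_univ, true_and] at h h'
    obtain rfl := ArrowGroupoid.inv_injective e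
    exact Prod.ext rfl ((ArrowGroupoid.IsComp.inv_comp h.1).unique
      (ArrowGroupoid.IsComp.inv_comp h'.1))
  · intro W hW
    simp only [Finset.mem_filter, Finset.mem_univ, true_and] at hW
    obtain ⟨Y, hY⟩ := ArrowGroupoid.exists_isComp hW.2
    refine ⟨(T.boxH.inv W, Y), ?_, T.boxH.inv_inv W⟩
    simp only [Finset.mem_filter, Finset.mem_univ, true_and]
    exact ⟨ArrowGroupoid.IsComp.inv_comp hY, by
      rw [top_invH, hW.1, ArrowGroupoid.inv_inv]⟩
  · rintro ⟨X, Y⟩ h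
    simp only [Finset.mem_filter, Finset.mem_univ, true_and] at h
    rw [h.2, bl, bot_invH, T.hor.src_inv]
    rfl

open Classical in
/-- The counterpart of `IsNormalized.sum_top` for sums that depend on the factorization `A = XY`
only through the weight `ϑ(tl(Y))` and the bottom side of `Y`. -/
theorem IsNormalized.sum_bot (hϑ : T.IsNormalized ϑ) (A : B) (F : H → M) :
    ∑ p ∈ Finset.univ.filter (fun p : B × B => T.HFactor A p.1 p.2),
      (ϑ (T.tl p.2) : k) • F (T.boxV.tgt p.2) =
    ∑ x ∈ Finset.univ.filter (fun x : H => T.hor.tgt x = T.br A), F x := by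
  rw [← Finset.sum_fiberwise_of_maps_to (g := fun p : B × B => T.boxV.tgt p.2)
    (t := Finset.univ.filter (fun x : H => T.hor.tgt x = T.br A))]
  swap
  · intro p hp
    simp only [Finset.mem_filter, Finset.mem_univ, true_and] at hp ⊢
    exact (br_eq_of_isComp hp).symm
  refine Finset.sum_congr rfl fun x hx => ?_
  simp only [Finset.mem_filter, Finset.mem_univ, true_and] at hx
  have key := hϑ (T.ver.inv (T.boxH.tgt A)) x (by rw [T.ver.src_inv, hx, br, T.corner_br])
  rw [← one_smul k (F x), ← key, Finset.sum_smul, Finset.filter_filter]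
  refine Finset.sum_bij (fun p _ => T.boxV.inv p.2) ?_ ?_ ?_ ?_
  · rintro ⟨X, Y⟩ h
    simp only [Finset.mem_filter, Finset.mem_univ, true_and] at h ⊢
    rw [right_invV, T.boxV.src_inv, ArrowGroupoid.IsComp.tgt_eq h.1]
    exact ⟨h.2, rfl⟩
  · rintro ⟨X, Y⟩ h ⟨X', Y'⟩ h' e
    simp only [Finset.mem_filter, Finset.mem_univ, true_and] at h h'
    obtain rfl := ArrowGroupoid.inv_injective e
    exact Prod.ext ((ArrowGroupoid.IsComp.comp_inv h.1).unique
      (ArrowGroupoid.IsComp.comp_inv h'.1)) rfl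
  · intro W hW
    simp only [Finset.mem_filter, Finset.mem_univ, true_and] at hW
    obtain ⟨X, hX⟩ := ArrowGroupoid.exists_isComp (G := T.boxH) (f := A)
      (g := T.boxH.inv (T.boxV.inv W))
      (by rw [T.boxH.src_inv, right_invV, hW.2, ArrowGroupoid.inv_inv])
    refine ⟨(X, T.boxV.inv W), ?_, T.boxV.inv_inv W⟩
    simp only [Finset.mem_filter, Finset.mem_univ, true_and]
    have h := hX.comp_inv
    rw [ArrowGroupoid.inv_inv] at h
    exact ⟨h, by rw [T.boxV.tgt_inv, hW.1]⟩
  · rintro ⟨X, Y⟩ h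
    simp only [Finset.mem_filter, Finset.mem_univ, true_and] at h
    rw [h.2, bl, T.boxV.tgt_inv]
    rfl

end Sums

namespace QuantumGroupoid

variable {k : Type*} [Field k] (ϑ : P → kˣ)

/-! ### Structure maps on the basis of boxes -/

theorem boxMul_of_isComp {A X Y : B} (h : T.boxV.IsComp A X Y) :
    boxMul T ϑ X Y = boxBasis T ϑ A := by
  obtain ⟨h, rfl⟩ := h
  rw [boxMul, dif_pos h]

theorem boxMul_of_ne {X Y : B} (h : T.boxV.tgt X ≠ T.boxV.src Y) : boxMul T ϑ X Y = 0 :=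
  dif_neg h

open Classical in
/-- The horizontal composite of two boxes if it is defined, and `0` otherwise. -/
noncomputable def boxHMul (X Y : B) : T.QuantumGroupoid ϑ :=
  if h : T.boxH.tgt X = T.boxH.src Y then boxBasis T ϑ (T.boxH.comp X Y h) else 0

theorem boxHMul_of_isComp {A X Y : B} (h : T.boxH.IsComp A X Y) :
    boxHMul ϑ X Y = boxBasis T ϑ A := by
  obtain ⟨h, rfl⟩ := h
  rw [boxHMul, dif_pos h]

theorem antipode_box (A : B) : antipode T ϑ (boxBasis T ϑ A) =
    ((ϑ (T.tr A) : k) / (ϑ (T.br A) : k)) • boxBasis T ϑ (T.boxInv A) := by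
  simp only [antipode, Module.Basis.constr_basis]

open Classical in
theorem counitMap_boxMul (X Y : B) : counitMap T ϑ (boxMul T ϑ X Y) =
    if ∃ g, T.boxV.IsComp (T.boxH.ident g) X Y then ((ϑ (T.bl Y) : k))⁻¹ else 0 := by
  by_cases h : T.boxV.tgt X = T.boxV.src Y
  · obtain ⟨Z, hZ⟩ := ArrowGroupoid.exists_isComp h
    rw [boxMul_of_isComp ϑ hZ, counitMap_box, bl, hZ.tgt_eq]
    refine if_congr ⟨?_, ?_⟩ rfl rfl
    · rintro ⟨g, rfl⟩
      exact ⟨g, hZ⟩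
    · rintro ⟨g, hg⟩
      exact ⟨g, hg.unique hZ⟩
  · rw [boxMul_of_ne ϑ h, map_zero, if_neg]
    rintro ⟨g, hg⟩
    exact h hg.1

variable [Fintype H]

theorem box_mul_box (X Y : B) : boxBasis T ϑ X * boxBasis T ϑ Y = boxMul T ϑ X Y :=
  mulMap_box T ϑ X Y

theorem box_mul_sum_identV (A : B) (f : H → k) :
    boxBasis T ϑ A * ∑ x, f x • boxBasis T ϑ (T.boxV.ident x) =
      f (T.boxV.tgt A) • boxBasis T ϑ A := by
  rw [Finset.mul_sum, Finset.sum_eq_single (T.boxV.tgt A)]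
  · rw [mul_smul_comm, box_mul_box, boxMul_of_isComp ϑ (T.boxV.isComp_ident_right A)]
  · intro x _ hx
    rw [mul_smul_comm, box_mul_box, boxMul_of_ne, smul_zero]
    rwa [T.boxV.src_ident, ne_comm]
  · simp

theorem sum_identV_mul_box (A : B) (f : H → k) :
    (∑ x, f x • boxBasis T ϑ (T.boxV.ident x)) * boxBasis T ϑ A =
      f (T.boxV.src A) • boxBasis T ϑ A := by
  rw [Finset.sum_mul, Finset.sum_eq_single (T.boxV.src A)]
  · rw [smul_mul_assoc, box_mul_box, boxMul_of_isComp ϑ (T.boxV.isComp_ident_left A)]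
  · intro x _ hx
    rw [smul_mul_assoc, box_mul_box, boxMul_of_ne, smul_zero]
    rwa [T.boxV.tgt_ident]
  · simp

variable [Fintype B]

open Classical in
theorem comul_box (A : B) : Coalgebra.comul (R := k) (boxBasis T ϑ A) =
    ∑ p ∈ Finset.univ.filter (fun p : B × B => T.HFactor A p.1 p.2),
      (ϑ (T.bl p.2) : k) • (boxBasis T ϑ p.1 ⊗ₜ[k] boxBasis T ϑ p.2) :=
  comulMap_box T ϑ A

open Classical in
theorem comul_one : Coalgebra.comul (R := k) (1 : T.QuantumGroupoid ϑ) =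
    ∑ x : H, ∑ p ∈ Finset.univ.filter (fun p : B × B => T.HFactor (T.boxV.ident x) p.1 p.2),
      (ϑ (T.bl p.2) : k) • (boxBasis T ϑ p.1 ⊗ₜ[k] boxBasis T ϑ p.2) := by
  rw [show (1 : T.QuantumGroupoid ϑ) = ∑ x : H, boxBasis T ϑ (T.boxV.ident x) from rfl, map_sum]
  exact Finset.sum_congr rfl fun x _ => comul_box ϑ _

/-! ### The source and target maps on boxes -/

open Classical in
theorem weakTarget_box (A : B) : weakTarget k (boxBasis T ϑ A) =
    ∑ x : H, ∑ p ∈ Finset.univ.filter (fun p : B × B => T.HFactor (T.boxV.ident x) p.1 p.2),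
      if ∃ g, T.boxV.IsComp (T.boxH.ident g) p.1 A then
        ((ϑ (T.bl p.2) : k) * (ϑ (T.bl A) : k)⁻¹) • boxBasis T ϑ p.2 else 0 := by
  rw [weakTarget, comul_one]
  simp only [Finset.sum_mul, map_sum, smul_mul_assoc, map_smul,
    Algebra.TensorProduct.tmul_mul_tmul, mul_one, LinearMap.rTensor_tmul, TensorProduct.lid_tmul,
    box_mul_box]
  refine Finset.sum_congr rfl fun x _ => Finset.sum_congr rfl fun p _ => ?_
  rw [show (Coalgebra.counit (R := k) (A := T.QuantumGroupoid ϑ)) = counitMap T ϑ from rfl,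
    counitMap_boxMul]
  split_ifs
  · rw [smul_smul]
  · rw [zero_smul, smul_zero]

open Classical in
theorem weakSource_box (A : B) : weakSource k (boxBasis T ϑ A) =
    ∑ x : H, ∑ p ∈ Finset.univ.filter (fun p : B × B => T.HFactor (T.boxV.ident x) p.1 p.2),
      if ∃ g, T.boxV.IsComp (T.boxH.ident g) A p.2 then boxBasis T ϑ p.1 else 0 := by
  rw [weakSource, comul_one]
  simp only [Finset.mul_sum, map_sum, mul_smul_comm, map_smul,
    Algebra.TensorProduct.tmul_mul_tmul, one_mul, LinearMap.lTensor_tmul, TensorProduct.rid_tmul,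
    box_mul_box]
  refine Finset.sum_congr rfl fun x _ => Finset.sum_congr rfl fun p _ => ?_
  rw [show (Coalgebra.counit (R := k) (A := T.QuantumGroupoid ϑ)) = counitMap T ϑ from rfl,
    counitMap_boxMul]
  split_ifs
  · rw [smul_smul, mul_inv_cancel₀ (Units.ne_zero _), one_smul]
  · rw [zero_smul, smul_zero]

theorem weakTarget_box_eq_zero {A : B} (hA : ∀ p, T.boxV.tgt A ≠ T.hor.ident p) :
    weakTarget k (boxBasis T ϑ A) = 0 := by
  classical
  rw [weakTarget_box]
  refine Finset.sum_eq_zero fun x _ => Finset.sum_eq_zero fun p _ => if_neg ?_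
  rintro ⟨g, h⟩
  exact hA _ (h.tgt_eq.symm.trans (T.bot_ident g))

theorem weakSource_box_eq_zero {A : B} (hA : ∀ p, T.boxV.src A ≠ T.hor.ident p) :
    weakSource k (boxBasis T ϑ A) = 0 := by
  classical
  rw [weakSource_box]
  refine Finset.sum_eq_zero fun x _ => Finset.sum_eq_zero fun p _ => if_neg ?_
  rintro ⟨g, h⟩
  exact hA _ (h.src_eq.symm.trans (T.top_ident g))

open Classical in
theorem weakTarget_box_of_isTargetBox {A E : B} (hE : T.IsTargetBox A E) :
    weakTarget k (boxBasis T ϑ A) =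
      ∑ x ∈ Finset.univ.filter (fun x : H => T.hor.src x = T.tl A),
        ((ϑ (T.tr A) : k) * (ϑ (T.bl A) : k)⁻¹) • boxHMul ϑ E (T.boxV.ident x) := by
  rw [weakTarget_box, Finset.sum_filter]
  refine Finset.sum_congr rfl fun x _ => ?_
  have hiff : ∀ {X Y : B}, T.HFactor (T.boxV.ident x) X Y →
      ((∃ g, T.boxV.IsComp (T.boxH.ident g) X A) ↔ X = T.boxH.inv E) := fun {X Y} h =>
    hE.isComp_identH_iff ((ArrowGroupoid.IsComp.src_eq h).symm.trans (T.left_ident x))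
  split_ifs with hx
  · obtain ⟨Y, hY⟩ := ArrowGroupoid.exists_isComp (G := T.boxH) (f := E) (g := T.boxV.ident x)
      (by rw [hE.right_eq, T.left_ident, hx])
    have hXY : T.HFactor (T.boxV.ident x) (T.boxH.inv E) Y := hY.inv_comp
    rw [Finset.sum_eq_single (T.boxH.inv E, Y)]
    · rw [if_pos ((hiff hXY).2 rfl), boxHMul_of_isComp ϑ hY]
      -- `bl(Y)` is the bottom left vertex of `E`, hence of `A⁻¹`.
      rw [bl_eq_of_isComp hY, bl, ArrowGroupoid.IsComp.tgt_eq hE, bot_boxInv, T.hor.src_inv]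
      rfl
    · rintro ⟨X', Y'⟩ h hne
      simp only [Finset.mem_filter, Finset.mem_univ, true_and] at h
      refine if_neg fun h' => hne ?_
      obtain rfl := (hiff h).1 h'
      exact Prod.ext rfl ((ArrowGroupoid.IsComp.inv_comp h).unique
        (ArrowGroupoid.IsComp.inv_comp hXY))
    · intro h
      exact (h (Finset.mem_filter.2 ⟨Finset.mem_univ _, hXY⟩)).elim
  · refine Finset.sum_eq_zero ?_
    rintro ⟨X, Y⟩ h
    simp only [Finset.mem_filter, Finset.mem_univ, true_and] at h
    refine if_neg fun h' => hx ?_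
    obtain rfl := (hiff h).1 h'
    have h₁ := ArrowGroupoid.IsComp.src_eq h
    rw [T.left_ident, T.boxH.src_inv, hE.right_eq] at h₁
    exact ArrowGroupoid.ident_injective h₁

open Classical in
theorem weakSource_box_of_isSourceBox {A E : B} (hE : T.IsSourceBox A E) :
    weakSource k (boxBasis T ϑ A) =
      ∑ x ∈ Finset.univ.filter (fun x : H => T.hor.tgt x = T.br A),
        boxHMul ϑ (T.boxV.ident x) E := by
  rw [weakSource_box, Finset.sum_filter]
  refine Finset.sum_congr rfl fun x _ => ?_
  have hiff : ∀ {X Y : B}, T.HFactor (T.boxV.ident x) X Y →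
      ((∃ g, T.boxV.IsComp (T.boxH.ident g) A Y) ↔ Y = T.boxH.inv E) := fun {X Y} h =>
    hE.isComp_identH_iff ((ArrowGroupoid.IsComp.tgt_eq h).symm.trans (T.right_ident x))
  split_ifs with hx
  · obtain ⟨X, hX⟩ := ArrowGroupoid.exists_isComp (G := T.boxH) (f := T.boxV.ident x) (g := E)
      (by rw [hE.left_eq, T.right_ident, hx])
    have hXY : T.HFactor (T.boxV.ident x) X (T.boxH.inv E) := hX.comp_inv
    rw [Finset.sum_eq_single (X, T.boxH.inv E)]
    · rw [if_pos ((hiff hXY).2 rfl), boxHMul_of_isComp ϑ hX]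
    · rintro ⟨X', Y'⟩ h hne
      simp only [Finset.mem_filter, Finset.mem_univ, true_and] at h
      refine if_neg fun h' => hne ?_
      obtain rfl := (hiff h).1 h'
      exact Prod.ext ((ArrowGroupoid.IsComp.comp_inv h).unique
        (ArrowGroupoid.IsComp.comp_inv hXY)) rfl
    · intro h
      exact (h (Finset.mem_filter.2 ⟨Finset.mem_univ _, hXY⟩)).elim
  · refine Finset.sum_eq_zero ?_
    rintro ⟨X, Y⟩ h
    simp only [Finset.mem_filter, Finset.mem_univ, true_and] at h
    refine if_neg fun h' => hx ?_
    obtain rfl := (hiff h).1 h'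
    have h₁ := ArrowGroupoid.IsComp.tgt_eq h
    rw [T.right_ident, T.boxH.tgt_inv, hE.left_eq] at h₁
    exact ArrowGroupoid.ident_injective h₁

end QuantumGroupoid

end DoubleGroupoid

/-! ### The source and target maps as linear maps -/

section WeakHopf

variable (k : Type*) {A : Type*} [CommRing k] [Ring A] [Algebra k A] [Coalgebra k A]

/-- `weakSource` as a linear map. -/
def weakSourceMap : A →ₗ[k] A where
  toFun := weakSource k
  map_add' a b := by simp only [weakSource, TensorProduct.tmul_add, add_mul, map_add]
  map_smul' c a := by
    simp only [weakSource, TensorProduct.tmul_smul, smul_mul_assoc, map_smul, RingHom.id_apply]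

/-- `weakTarget` as a linear map. -/
def weakTargetMap : A →ₗ[k] A where
  toFun := weakTarget k
  map_add' a b := by simp only [weakTarget, TensorProduct.add_tmul, mul_add, map_add]
  map_smul' c a := by
    simp only [weakTarget, ← TensorProduct.smul_tmul', mul_smul_comm, map_smul, RingHom.id_apply]

end WeakHopf

namespace DoubleGroupoid

namespace QuantumGroupoid

variable {P H V B : Type*} {T : DoubleGroupoid P H V B} {k : Type*} [Field k] {ϑ : P → kˣ}

/-! ### The antipode -/

section Antipode

variable [Fintype H] [Fintype B]

theorem id_mul_antipode_box (hϑ : T.IsNormalized ϑ) (A : B) :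
    LinearMap.mul' k _ (TensorProduct.map LinearMap.id (antipode T ϑ)
      (Coalgebra.comul (R := k) (boxBasis T ϑ A))) = weakTarget k (boxBasis T ϑ A) := by
  classical
  rw [comul_box]
  simp only [map_sum, map_smul, TensorProduct.map_tmul, LinearMap.id_apply, antipode_box,
    TensorProduct.tmul_smul, LinearMap.mul'_apply, box_mul_box]
  by_cases hA : ∃ p, T.boxV.tgt A = T.hor.ident p
  · obtain ⟨q, hA⟩ := hA
    obtain ⟨E, hE⟩ := exists_isTargetBox hA
    rw [weakTarget_box_of_isTargetBox ϑ hE, ← hϑ.sum_top A (k := k)]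
    refine Finset.sum_congr rfl ?_
    rintro ⟨X, Y⟩ h
    simp only [Finset.mem_filter, Finset.mem_univ, true_and] at h
    obtain ⟨Z, hZ, hZ'⟩ := hE.exists_comp hA h
    have hq : T.bl A = T.br A := by rw [bl, br, hA, T.hor.src_ident, T.hor.tgt_ident]
    rw [boxMul_of_isComp ϑ hZ, boxHMul_of_isComp ϑ hZ', br_eq_bl_of_isComp h,
      tr_eq_of_isComp h, hq, br_eq_of_isComp h, div_eq_mul_inv]
  · push Not at hA
    rw [weakTarget_box_eq_zero ϑ hA]
    refine Finset.sum_eq_zero ?_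
    rintro ⟨X, Y⟩ h
    simp only [Finset.mem_filter, Finset.mem_univ, true_and] at h
    rw [boxMul_of_ne, smul_zero, smul_zero]
    intro hXY
    rw [top_boxInv] at hXY
    have hb := bot_isComp h
    rw [hXY] at hb
    exact hA _ (hb.unique (T.hor.isComp_inv_left _))

theorem antipode_mul_id_box (hϑ : T.IsNormalized ϑ) (A : B) :
    LinearMap.mul' k _ (TensorProduct.map (antipode T ϑ) LinearMap.id
      (Coalgebra.comul (R := k) (boxBasis T ϑ A))) = weakSource k (boxBasis T ϑ A) := by
  classical
  rw [comul_box]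
  simp only [map_sum, map_smul, TensorProduct.map_tmul, LinearMap.id_apply, antipode_box,
    ← TensorProduct.smul_tmul', LinearMap.mul'_apply, box_mul_box]
  by_cases hA : ∃ p, T.boxV.src A = T.hor.ident p
  · obtain ⟨q, hA⟩ := hA
    obtain ⟨E, hE⟩ := exists_isSourceBox hA
    rw [weakSource_box_of_isSourceBox ϑ hE, ← hϑ.sum_bot A (k := k)]
    refine Finset.sum_congr rfl ?_
    rintro ⟨X, Y⟩ h
    simp only [Finset.mem_filter, Finset.mem_univ, true_and] at h
    obtain ⟨Z, hZ, hZ'⟩ := hE.exists_comp hA h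
    rw [boxMul_of_isComp ϑ hZ, boxHMul_of_isComp ϑ hZ', br_eq_bl_of_isComp h,
      tr_eq_tl_of_isComp h, smul_smul, mul_div_cancel₀ _ (Units.ne_zero _)]
  · push Not at hA
    rw [weakSource_box_eq_zero ϑ hA]
    refine Finset.sum_eq_zero ?_
    rintro ⟨X, Y⟩ h
    simp only [Finset.mem_filter, Finset.mem_univ, true_and] at h
    rw [boxMul_of_ne, smul_zero, smul_zero]
    intro hXY
    rw [bot_boxInv] at hXY
    have ht := top_isComp h
    rw [← hXY] at ht
    exact hA _ (ht.unique (T.hor.isComp_inv_right _))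

open Classical in
theorem weakSource_mul_boxInv {A X Y : B} (h : T.boxH.IsComp A X Y) :
    weakSource k (boxBasis T ϑ X) * boxBasis T ϑ (T.boxInv Y) =
      if ∃ p, T.boxV.src X = T.hor.ident p then boxBasis T ϑ (T.boxInv A) else 0 := by
  split_ifs with hX
  · obtain ⟨q, hX⟩ := hX
    obtain ⟨E, hE⟩ := exists_isSourceBox hX
    rw [weakSource_box_of_isSourceBox ϑ hE, Finset.sum_mul]
    -- Each summand `id_x E` has bottom side `x`, so only the summand with `x = t(Y⁻¹)` survives.
    have hterm : ∀ x, T.hor.tgt x = T.br X → ∃ Z,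
        T.boxH.IsComp Z (T.boxV.ident x) E ∧ T.boxV.tgt Z = x := fun x hx => by
      obtain ⟨Z, hZ⟩ := ArrowGroupoid.exists_isComp (G := T.boxH) (f := T.boxV.ident x) (g := E)
        (by rw [hE.left_eq, T.right_ident, hx])
      have hb := bot_isComp hZ
      rw [hE.bot_eq, T.boxV.tgt_ident] at hb
      exact ⟨Z, hZ, hb.eq_of_ident_right⟩
    have hx₀ : T.hor.tgt (T.hor.inv (T.boxV.tgt Y)) = T.br X := by
      rw [T.hor.tgt_inv, br_eq_bl_of_isComp h, bl]
    rw [Finset.sum_eq_single (T.hor.inv (T.boxV.tgt Y))]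
    · obtain ⟨Z, hZ, -⟩ := hterm _ hx₀
      rw [boxHMul_of_isComp ϑ hZ, box_mul_box, boxMul_of_isComp ϑ (hE.isComp_boxInv h hZ)]
    · intro x hx hne
      simp only [Finset.mem_filter, Finset.mem_univ, true_and] at hx
      obtain ⟨Z, hZ, hb⟩ := hterm x hx
      rw [boxHMul_of_isComp ϑ hZ, box_mul_box, boxMul_of_ne]
      rwa [hb, top_boxInv]
    · intro h'
      exact (h' (Finset.mem_filter.2 ⟨Finset.mem_univ _, hx₀⟩)).elim
  · push Not at hX
    rw [weakSource_box_eq_zero ϑ hX, zero_mul]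

theorem weakSource_mul_antipode_box (hϑ : T.IsNormalized ϑ) (A : B) :
    LinearMap.mul' k _ (TensorProduct.map (weakSourceMap k) (antipode T ϑ)
      (Coalgebra.comul (R := k) (boxBasis T ϑ A))) = antipode T ϑ (boxBasis T ϑ A) := by
  classical
  have hterm : ∀ p ∈ Finset.univ.filter (fun p : B × B => T.HFactor A p.1 p.2),
      LinearMap.mul' k _ (TensorProduct.map (weakSourceMap k) (antipode T ϑ)
        ((ϑ (T.bl p.2) : k) • (boxBasis T ϑ p.1 ⊗ₜ[k] boxBasis T ϑ p.2))) =
      (ϑ (T.br p.1) : k) • if ∃ q, T.boxV.src p.1 = T.hor.ident q then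
        antipode T ϑ (boxBasis T ϑ A) else 0 := by
    rintro ⟨X, Y⟩ h
    simp only [Finset.mem_filter, Finset.mem_univ, true_and] at h
    rw [map_smul, map_smul, TensorProduct.map_tmul, LinearMap.mul'_apply, antipode_box,
      antipode_box, mul_smul_comm, show weakSourceMap k (boxBasis T ϑ X) =
        weakSource k (boxBasis T ϑ X) from rfl, weakSource_mul_boxInv h, br_eq_bl_of_isComp h,
      tr_eq_of_isComp h, br_eq_of_isComp h, smul_ite, smul_zero]
  rw [comul_box, map_sum, map_sum, Finset.sum_congr rfl hterm,
    hϑ.sum_top A (k := k) fun x => if ∃ q, x = T.hor.ident q then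
      antipode T ϑ (boxBasis T ϑ A) else 0,
    Finset.sum_eq_single (T.hor.ident (T.tl A))]
  · exact if_pos ⟨_, rfl⟩
  · rintro x hx hne
    simp only [Finset.mem_filter, Finset.mem_univ, true_and] at hx
    refine if_neg ?_
    rintro ⟨q, rfl⟩
    exact hne (by rw [← hx, T.hor.src_ident])
  · intro h
    exact (h (Finset.mem_filter.2 ⟨Finset.mem_univ _, T.hor.src_ident _⟩)).elim

theorem isWeakAntipode_antipode (hϑ : T.IsNormalized ϑ) : IsWeakAntipode k (antipode T ϑ) := by
  have target : LinearMap.mul' k _ ∘ₗ TensorProduct.map LinearMap.id (antipode T ϑ) ∘ₗ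
      Coalgebra.comul (R := k) = weakTargetMap k :=
    (boxBasis T ϑ).ext (id_mul_antipode_box hϑ)
  have source : LinearMap.mul' k _ ∘ₗ TensorProduct.map (antipode T ϑ) LinearMap.id ∘ₗ
      Coalgebra.comul (R := k) = weakSourceMap k :=
    (boxBasis T ϑ).ext (antipode_mul_id_box hϑ)
  have anti : LinearMap.mul' k _ ∘ₗ TensorProduct.map (weakSourceMap k) (antipode T ϑ) ∘ₗ
      Coalgebra.comul (R := k) = antipode T ϑ :=
    (boxBasis T ϑ).ext (weakSource_mul_antipode_box hϑ)
  refine ⟨fun a => LinearMap.congr_fun target a, fun a => LinearMap.congr_fun source a,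
    fun a => ?_⟩
  rw [source]
  exact LinearMap.congr_fun anti a

end Antipode

/-! ### The pivotal element -/

section Pivotal

variable [Fintype H]

variable (T ϑ) in
/-- The element `∑ (ϑ(r(x)) / ϑ(l(x))) id x`, inverse to the pivotal element. -/
noncomputable def pivotalInverse : T.QuantumGroupoid ϑ :=
  ∑ x : H, ((ϑ (T.hor.tgt x) : k) / (ϑ (T.hor.src x) : k)) • boxBasis T ϑ (T.boxV.ident x)

theorem box_mul_pivotalElement (A : B) : boxBasis T ϑ A * pivotalElement T ϑ =
    ((ϑ (T.bl A) : k) / (ϑ (T.br A) : k)) • boxBasis T ϑ A :=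
  box_mul_sum_identV ϑ A fun x => (ϑ (T.hor.src x) : k) / (ϑ (T.hor.tgt x) : k)

theorem pivotalElement_mul_box (A : B) : pivotalElement T ϑ * boxBasis T ϑ A =
    ((ϑ (T.tl A) : k) / (ϑ (T.tr A) : k)) • boxBasis T ϑ A :=
  sum_identV_mul_box ϑ A fun x => (ϑ (T.hor.src x) : k) / (ϑ (T.hor.tgt x) : k)

theorem pivotalInverse_mul_box (A : B) : pivotalInverse T ϑ * boxBasis T ϑ A =
    ((ϑ (T.tr A) : k) / (ϑ (T.tl A) : k)) • boxBasis T ϑ A :=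
  sum_identV_mul_box ϑ A fun x => (ϑ (T.hor.tgt x) : k) / (ϑ (T.hor.src x) : k)

theorem pivotalInverse_mul_pivotalElement : pivotalInverse T ϑ * pivotalElement T ϑ = 1 := by
  rw [pivotalElement, Finset.mul_sum]
  refine Finset.sum_congr rfl fun x _ => ?_
  rw [mul_smul_comm, pivotalInverse_mul_box, smul_smul, tr, tl, T.boxV.src_ident,
    div_mul_div_cancel₀ (Units.ne_zero _), div_self (Units.ne_zero _), one_smul]

theorem pivotalElement_mul_pivotalInverse : pivotalElement T ϑ * pivotalInverse T ϑ = 1 := by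
  rw [pivotalInverse, Finset.mul_sum]
  refine Finset.sum_congr rfl fun x _ => ?_
  rw [mul_smul_comm, pivotalElement_mul_box, smul_smul, tr, tl, T.boxV.src_ident,
    div_mul_div_cancel₀ (Units.ne_zero _), div_self (Units.ne_zero _), one_smul]

theorem inverse_pivotalElement : Ring.inverse (pivotalElement T ϑ) = pivotalInverse T ϑ :=
  Ring.inverse_unit (⟨_, _, pivotalElement_mul_pivotalInverse,
    pivotalInverse_mul_pivotalElement⟩ : (T.QuantumGroupoid ϑ)ˣ)

theorem antipode_antipode (a : T.QuantumGroupoid ϑ) : antipode T ϑ (antipode T ϑ a) =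
    Ring.inverse (pivotalElement T ϑ) * a * pivotalElement T ϑ := by
  rw [inverse_pivotalElement]
  induction a using box_induction with
  | h0 => simp
  | hadd a b ha hb => simp only [map_add, ha, hb, mul_add, add_mul]
  | hsmul c a ha => simp only [map_smul, ha, mul_smul_comm, smul_mul_assoc]
  | hbox A =>
    rw [pivotalInverse_mul_box, smul_mul_assoc, box_mul_pivotalElement, antipode_box, map_smul,
      antipode_box, boxInv_boxInv, smul_smul, smul_smul]
    -- The right vertices of `A⁻¹` are the left vertices of `A`, with top and bottom exchanged.
    rw [show T.tr (T.boxInv A) = T.bl A by rw [tr, top_boxInv, T.hor.tgt_inv, bl],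
      show T.br (T.boxInv A) = T.tl A by rw [br, bot_boxInv, T.hor.tgt_inv, tl],
      div_mul_div_comm, div_mul_div_comm, mul_comm (ϑ (T.br A) : k)]

variable [Fintype B]

/-- In `Δ(id x) = ∑ ϑ(bl(Y)) X ⊗ Y`, the factors by which `G` acts on `X` and on `Y` multiply to
the one by which it acts on `id x`, because `X` and `Y` share their middle vertices. -/
theorem isWeakGroupLike_pivotalElement : IsWeakGroupLike k (pivotalElement T ϑ) where
  isUnit := ⟨⟨_, _, pivotalElement_mul_pivotalInverse, pivotalInverse_mul_pivotalElement⟩, rfl⟩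
  comul_eq := by
    classical
    rw [comul_one]
    conv_lhs => rw [pivotalElement, map_sum]
    rw [Finset.sum_mul]
    refine Finset.sum_congr rfl fun x _ => ?_
    rw [map_smul, comul_box, Finset.smul_sum, Finset.sum_mul]
    refine Finset.sum_congr rfl ?_
    rintro ⟨X, Y⟩ h
    simp only [Finset.mem_filter, Finset.mem_univ, true_and] at h
    have hl : T.hor.src x = T.bl X := by
      rw [← bl_eq_of_isComp h, bl, T.boxV.tgt_ident]
    have hr : T.hor.tgt x = T.br Y := by
      rw [← br_eq_of_isComp h, br, T.boxV.tgt_ident]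
    rw [smul_mul_assoc, Algebra.TensorProduct.tmul_mul_tmul, box_mul_pivotalElement,
      box_mul_pivotalElement, TensorProduct.smul_tmul_smul, br_eq_bl_of_isComp h, hl, hr,
      div_mul_div_cancel₀ (Units.ne_zero _), smul_comm]
  comul_eq' := by
    classical
    rw [comul_one]
    conv_lhs => rw [pivotalElement, map_sum]
    rw [Finset.mul_sum]
    refine Finset.sum_congr rfl fun x _ => ?_
    rw [map_smul, comul_box, Finset.smul_sum, Finset.mul_sum]
    refine Finset.sum_congr rfl ?_
    rintro ⟨X, Y⟩ h
    simp only [Finset.mem_filter, Finset.mem_univ, true_and] at h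
    have hl : T.hor.src x = T.tl X := by
      rw [← tl_eq_of_isComp h, tl, T.boxV.src_ident]
    have hr : T.hor.tgt x = T.tr Y := by
      rw [← tr_eq_of_isComp h, tr, T.boxV.src_ident]
    rw [mul_smul_comm, Algebra.TensorProduct.tmul_mul_tmul, pivotalElement_mul_box,
      pivotalElement_mul_box, TensorProduct.smul_tmul_smul, tr_eq_tl_of_isComp h, hl, hr,
      div_mul_div_cancel₀ (Units.ne_zero _), smul_comm]

end Pivotal

end QuantumGroupoid

end DoubleGroupoid

theorem mainTheorem4 {P H V B : Type*} [Fintype H] [Fintype B]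
    {k : Type*} [Field k] [CharZero k] (T : DoubleGroupoid P H V B)
    (ϑ : P → kˣ) (hϑ : T.IsNormalized ϑ) :
    IsWeakAntipode k (DoubleGroupoid.QuantumGroupoid.antipode T ϑ) ∧
      IsWeakPivotal k (DoubleGroupoid.QuantumGroupoid.antipode T ϑ)
        (DoubleGroupoid.QuantumGroupoid.pivotalElement T ϑ) :=
  ⟨DoubleGroupoid.QuantumGroupoid.isWeakAntipode_antipode hϑ,
    DoubleGroupoid.QuantumGroupoid.isWeakGroupLike_pivotalElement,
    DoubleGroupoid.QuantumGroupoid.antipode_antipode⟩
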